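/- Let $A=\{0,1,g,k,p,1'\}$ (empty space, empty door, ghost, keymaster ghost, pacman, door with ghost), put $F=\{0,g,k\}$ and $D=\{1,1'\}$, and let $A^{\mathbb Z}$ carry the metric $d(x,y)=2^{-\min\{|j|\,:\,x_j\ne y_j\}}$ for $x\neq y$, $d(x,x)=0$. Let $T:A^{\mathbb Z}\to A^{\mathbb Z}$ be the Pacman map, defined by $(Tx)_i=R(x_{i-1},x_i,x_{i+1})$, where for all $l,c,r\in A$ the value $R(l,c,r)$ is the symbol whose condition below is met (exactly one is met): - $0$: [$l\in F$ and ($(c\in F$ and $r\in\{0,1,p\})$ or $(c=p$ and $r\notin D)$)] or [$l\in D$ and ($(c\in\{0,k\}$ and $r\in\{0,1,p\})$ or $(c=p$ and $r\notin D)$)]; - $1$: $c\in D$ and $r\notin\{k,1'\}$; - $g$: [$l\in F$, $c\in F$ and $r\in\{g,1'\}$] or [$l\in D$, $c\in\{0,k\}$ and $r=1'$]; - $k$: [$r=k$ and ($(l\in F$ and $c\in F)$ or $(l\in D$ and $c\in\{0,k\})$)] or [$l=p$, $c\notin D$ and $r\in D$] or [$c=p$ and $r\in D$]; - $p$: [$l\in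 D$ and ($(c\in\{0,k\}$ and $r=g)$ or $c=g$)] or [$l=p$, $c\notin D$ and $r\notin D$]; - $1'$: $c\in D$ and $r\in\{k,1'\}$. Write $B_\delta(x)=\{y:d(x,y)<\delta\}$. A point $x$ is a *mean equicontinuity point* if for every $\varepsilon>0$ there is $\delta>0$ such that $\limsup_{n\to\infty}\frac1n\sum_{i=1}^n d(T^ix,T^iy)<\varepsilon$ for every $y\in B_\delta(x)$; it is a *diam-mean equicontinuity point* if for every $\varepsilon>0$ there is $\delta>0$ such that $\limsup_{n\to\infty}\frac1n\sum_{i=1}^n \operatorname{diam}(T^iB_\delta(x))<\varepsilon$. The map $T$ is *almost (diam-)mean equicontinuous* if the set of its (diam-)mean equicontinuity points is residual (comeagre). A *cellular automaton* is a continuous self-map of a full shift over a finite alphabet that commutes with the shift $\sigma(x)_i=x_{i+1}$. Then: 1. $T$ is a cellular automaton. 2. $T$ is almost mean equicontinuous, and the set of its mean equicontinuity points is dense. 3. $T$ is not almost diam-mean equicontinuous. 4. $T$ is cofinitely sensitive: there is $\delta>0$ such that for every nonempty open $U\subseteq A^{\mathbb Z}$ the set $\{n\in\mathbb N:\operatorname{diam}(T^nU)>\delta\}$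 has finite complement. 5. No point is a diam-mean equicontinuity point of $T$. Moreover, there is a constant $c>0$ such that for every $x\in A^{\mathbb Z}$ and every $\delta>0$ one has $\frac1n\sum_{i=1}^n\operatorname{diam}(T^iB_\delta(x))>c$ for all sufficiently large $n$. In particular, there exists an almost mean equicontinuous cellular automaton that is not almost diam-mean equicontinuous. -/

import Mathlib

/-! ### Mean notions for a self-map of a metric space -/

namespace MeanDynamics

/-- The mean equicontinuity points of `T`. -/
def meanEquicontinuityPoints {X : Type*} [MetricSpace X] (T : X → X) : Set X :=
  {x | ∀ ε : ℝ, 0 < ε → ∃ δ : ℝ, 0 < δ ∧ ∀ y ∈ Metric.ball x δ,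
    Filter.limsup
      (fun n : ℕ => (∑ i ∈ Finset.Icc 1 n, dist (T^[i] x) (T^[i] y)) / (n : ℝ))
      Filter.atTop < ε}

/-- The average `(1/n) ∑_{i=1}^n diam (T^i U)`. -/
noncomputable def diamAverage {X : Type*} [MetricSpace X] (T : X → X) (U : Set X) (n : ℕ) : ℝ :=
  (∑ i ∈ Finset.Icc 1 n, Metric.diam (T^[i] '' U)) / (n : ℝ)

/-- The diam-mean equicontinuity points of `T`. -/
def diamMeanEquicontinuityPoints {X : Type*} [MetricSpace X] (T : X → X) : Set X :=
  {x | ∀ ε : ℝ, 0 < ε → ∃ δ : ℝ, 0 < δ ∧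
    Filter.limsup (diamAverage T (Metric.ball x δ)) Filter.atTop < ε}

/-- `T` is almost mean equicontinuous: the mean equicontinuity points form a residual set. -/
def AlmostMeanEquicontinuous {X : Type*} [MetricSpace X] (T : X → X) : Prop :=
  meanEquicontinuityPoints T ∈ residual X

/-- `T` is almost diam-mean equicontinuous: the diam-mean equicontinuity points form a
residual set. -/
def AlmostDiamMeanEquicontinuous {X : Type*} [MetricSpace X] (T : X → X) : Prop :=
  diamMeanEquicontinuityPoints T ∈ residual X

/-- `T` is cofinitely sensitive: for some `δ > 0` and every nonempty open `U`, the set of `n`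
with `diam (T^n U) > δ` is cofinite. -/
def CofinitelySensitive {X : Type*} [MetricSpace X] (T : X → X) : Prop :=
  ∃ δ : ℝ, 0 < δ ∧ ∀ U : Set X, IsOpen U → U.Nonempty →
    {n : ℕ | δ < Metric.diam (T^[n] '' U)}ᶜ.Finite

end MeanDynamics

/-! ### Full shifts and cellular automata -/

/-- The full shift `A^ℤ`. It is a separate type (not an abbreviation), so that it carries the
metric defined below and no other topology. -/
def FullShift (A : Type*) : Type _ := ℤ → A

namespace FullShift

open Classical in
/-- `d(x,y) = 2^{-i}` with `i = min {|j| : x_j ≠ y_j}` if `x ≠ y`, and `d(x,x) = 0`. -/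
noncomputable def shiftDist {A : Type*} (x y : FullShift A) : ℝ :=
  if x = y then 0
  else (1 / 2 : ℝ) ^ sInf {n : ℕ | ∃ j : ℤ, j.natAbs = n ∧ x j ≠ y j}

theorem shiftDist_self {A : Type*} (x : FullShift A) : shiftDist x x = 0 := by
  simp [shiftDist]

theorem shiftDist_nonneg {A : Type*} (x y : FullShift A) : 0 ≤ shiftDist x y := by
  unfold shiftDist
  split_ifs
  · exact le_rfl
  · positivity

theorem shiftDist_comm {A : Type*} (x y : FullShift A) : shiftDist x y = shiftDist y x := by
  unfold shiftDist
  by_cases h : x = y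
  · rw [if_pos h, if_pos h.symm]
  · rw [if_neg h, if_neg (fun h' => h h'.symm)]
    simp only [ne_comm]

theorem shiftDist_le_of_agree {A : Type*} {x y : FullShift A} {k : ℕ}
    (h : ∀ j : ℤ, j.natAbs < k → x j = y j) : shiftDist x y ≤ (1 / 2 : ℝ) ^ k := by
  unfold shiftDist
  split_ifs with hxy
  · positivity
  · obtain ⟨j, hj⟩ := Function.ne_iff.mp hxy
    refine pow_le_pow_of_le_one (by norm_num) (by norm_num) (le_csInf ⟨_, j, rfl, hj⟩ ?_)
    rintro n ⟨i, rfl, hi⟩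
    by_contra hlt
    exact hi (h i (not_le.mp hlt))

theorem le_shiftDist_of_ne {A : Type*} {x y : FullShift A} {j : ℤ} (h : x j ≠ y j) :
    (1 / 2 : ℝ) ^ j.natAbs ≤ shiftDist x y := by
  unfold shiftDist
  rw [if_neg (fun hxy => h (by rw [hxy]))]
  exact pow_le_pow_of_le_one (by norm_num) (by norm_num) (Nat.sInf_le ⟨j, rfl, h⟩)

theorem shiftDist_triangle {A : Type*} (x y z : FullShift A) :
    shiftDist x z ≤ shiftDist x y + shiftDist y z := by
  have hxy := shiftDist_nonneg x y
  have hyz := shiftDist_nonneg y z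
  by_cases h : x = z
  · rw [h, shiftDist_self]
    rw [h] at hxy
    exact add_nonneg hxy hyz
  · obtain ⟨j, hj, hne⟩ : sInf {n : ℕ | ∃ j : ℤ, j.natAbs = n ∧ x j ≠ z j} ∈
        {n : ℕ | ∃ j : ℤ, j.natAbs = n ∧ x j ≠ z j} := by
      obtain ⟨j, hj⟩ := Function.ne_iff.mp h
      exact Nat.sInf_mem ⟨_, j, rfl, hj⟩
    have hd : shiftDist x z = (1 / 2 : ℝ) ^ j.natAbs := by
      rw [shiftDist, if_neg h, hj]
    rw [hd]
    by_cases h1 : x j = y j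
    · have := le_shiftDist_of_ne (x := y) (y := z) (j := j) (by rw [← h1]; exact hne)
      linarith
    · have := le_shiftDist_of_ne h1
      linarith

noncomputable instance instMetricSpace {A : Type*} : MetricSpace (FullShift A) where
  dist := shiftDist
  dist_self := shiftDist_self
  dist_comm := shiftDist_comm
  dist_triangle := shiftDist_triangle
  eq_of_dist_eq_zero := by
    intro x y h
    by_contra hxy
    obtain ⟨j, hj⟩ := Function.ne_iff.mp hxy
    have h1 := le_shiftDist_of_ne hj
    have h2 : (0 : ℝ) < (1 / 2 : ℝ) ^ j.natAbs := by positivity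
    have h3 : shiftDist x y = 0 := h
    linarith

/-- The full shift over a finite alphabet is compact. -/
instance instCompactSpace {A : Type*} [Finite A] : CompactSpace (FullShift A) := by
  let _ : TopologicalSpace A := ⊥
  have _ : DiscreteTopology A := ⟨rfl⟩
  let f : (ℤ → A) → FullShift A := fun x => x
  have hf : Continuous f := by
    rw [continuous_iff_continuousAt]
    intro x
    rw [ContinuousAt, Metric.tendsto_nhds]
    intro ε hε
    obtain ⟨k, hk⟩ := exists_pow_lt_of_lt_one hε (by norm_num : (1 / 2 : ℝ) < 1)
    have hfin : {j : ℤ | j.natAbs < k}.Finite :=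
      (Set.finite_Icc (-(k : ℤ)) k).subset (fun j hj => by
        change j.natAbs < k at hj
        simp only [Set.mem_Icc]
        omega)
    have hev : ∀ᶠ y : ℤ → A in nhds x, ∀ j ∈ {j : ℤ | j.natAbs < k}, y j = x j := by
      rw [Filter.eventually_all_finite hfin]
      intro j _
      exact (continuous_apply j).continuousAt.eventually
        ((isOpen_discrete {x j}).mem_nhds rfl)
    filter_upwards [hev] with y hy
    exact (shiftDist_le_of_agree hy).trans_lt hk
  exact Function.Surjective.compactSpace (f := f) hf (fun x => ⟨x, rfl⟩)

/-- The shift map `σ(x)_i = x_{i+1}`. -/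
def shift {A : Type*} (x : FullShift A) : FullShift A := fun i => x (i + 1)

/-- A self-map of the full shift over the finite alphabet `A` is a cellular automaton if it is
continuous and commutes with the shift. -/
def IsCellularAutomaton {A : Type*} [Finite A] (T : FullShift A → FullShift A) : Prop :=
  Continuous T ∧ shift ∘ T = T ∘ shift

end FullShift

/-! ### The Pacman cellular automaton -/

/-- The six symbols: empty space, empty door, ghost, keymaster ghost, pacman, door with ghost. -/
inductive PacmanCell : Type
  | empty
  | door
  | ghost
  | key
  | pacman
  | ghostDoor
  deriving DecidableEq

namespace PacmanCell

instance : Fintype PacmanCell where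
  elems := {empty, door, ghost, key, pacman, ghostDoor}
  complete := by intro a; cases a <;> decide

/-- The symbols `empty`, `ghost`, `key`. -/
def IsFree (a : PacmanCell) : Prop := a = empty ∨ a = ghost ∨ a = key

/-- The two door symbols. -/
def IsDoor (a : PacmanCell) : Prop := a = door ∨ a = ghostDoor

instance : DecidablePred IsFree := fun a => by unfold IsFree; infer_instance

instance : DecidablePred IsDoor := fun a => by unfold IsDoor; infer_instance

/-- The condition on `(l, c, r) = (x_{i-1}, x_i, x_{i+1})` under which the symbol `v` is written
at position `i`. -/
def Writes (l c r : PacmanCell) : PacmanCell → Prop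
  | empty =>
      (IsFree l ∧ ((IsFree c ∧ (r = empty ∨ r = door ∨ r = pacman)) ∨ (c = pacman ∧ ¬ IsDoor r))) ∨
      (IsDoor l ∧ (((c = empty ∨ c = key) ∧ (r = empty ∨ r = door ∨ r = pacman)) ∨
        (c = pacman ∧ ¬ IsDoor r)))
  | door => IsDoor c ∧ ¬ (r = key ∨ r = ghostDoor)
  | ghost =>
      (IsFree l ∧ IsFree c ∧ (r = ghost ∨ r = ghostDoor)) ∨
      (IsDoor l ∧ (c = empty ∨ c = key) ∧ r = ghostDoor)
  | key =>
      (r = key ∧ ((IsFree l ∧ IsFree c) ∨ (IsDoor l ∧ (c = empty ∨ c = key)))) ∨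
      (l = pacman ∧ ¬ IsDoor c ∧ IsDoor r) ∨
      (c = pacman ∧ IsDoor r)
  | pacman =>
      (IsDoor l ∧ (((c = empty ∨ c = key) ∧ r = ghost) ∨ c = ghost)) ∨
      (l = pacman ∧ ¬ IsDoor c ∧ ¬ IsDoor r)
  | ghostDoor => IsDoor c ∧ (r = key ∨ r = ghostDoor)

instance (l c r : PacmanCell) : DecidablePred (Writes l c r) := fun v => by
  cases v <;> (unfold Writes; infer_instance)

/-- The local rule, of radius `1`: the symbol whose condition in `Writes` is met. -/
def rule (l c r : PacmanCell) : PacmanCell :=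
  if Writes l c r empty then empty
  else if Writes l c r door then door
  else if Writes l c r ghost then ghost
  else if Writes l c r key then key
  else if Writes l c r pacman then pacman
  else ghostDoor

/-- For every `(l, c, r)`, exactly one of the six conditions holds, namely that for
`rule l c r`. -/
theorem writes_iff (l c r v : PacmanCell) : Writes l c r v ↔ rule l c r = v := by
  revert l c r v
  set_option maxRecDepth 100000 in decide

end PacmanCell

/-- The Pacman cellular automaton. -/
def pacmanCA (x : FullShift PacmanCell) : FullShift PacmanCell :=
  fun i => PacmanCell.rule (x (i - 1)) (x i) (x (i + 1))

/-! Doors never move, and they split the line into compartments. A particle crosses its compartment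
three times: as a ghost it runs left to a door, turns into pacman and runs right, turns into a
keymaster at the right door, runs left again and passes the left door, becoming a ghost beyond it.
Only a pacman destroys particles, by meeting ghosts. Since the doors crossed and the progress in the
compartment combine into a decreasing potential (`exists_parent`), a region between doors empties in
bounded time once nothing enters from the right (`quiet_of_no_input`).

Sensitivity: frame a window by doors and send one keymaster from far away through empty space. By
the time it arrives the window is quiet, so it wanders alone and must visit the origin after a delay
that does not depend on its starting distance. Choosing that distance hits every large time
(`exists_separated`), so all balls eventually have images of diameter at least 1. This rules out
diam-mean equicontinuity everywhere.

Mean equicontinuity: tracing keymasters back through a door-free gap of length `L` shows that past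
the transient they leave it at times at least `L` apart (`IsGap.le_of_key`), since the pacman behind
one would meet the ghost behind the next. If `L` is large compared with the evacuation time of the
region to the left, that region is quiet most of the time, whatever lies further right. Quiet cells
are determined by the doors, so nearby orbits agree there most of the time. Generic points have such
gaps at every scale. -/

namespace PacmanCell

/-- The symbols `empty` and `door`, which carry no particle. -/
def Quiet (a : PacmanCell) : Prop := a = empty ∨ a = door

instance : DecidablePred Quiet := fun a => by unfold Quiet; infer_instance

/-! ### Case facts about the local rule -/

theorem isDoor_rule_iff (l c r : PacmanCell) : IsDoor (rule l c r) ↔ IsDoor c := by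
  revert l c r
  decide

theorem rule_eq_ghost {l c r : PacmanCell} (h : rule l c r = ghost) :
    ¬ IsDoor c ∧ (r = ghost ∨ r = ghostDoor) := by
  revert l c r
  decide

theorem rule_eq_ghostDoor {l c r : PacmanCell} (h : rule l c r = ghostDoor) :
    IsDoor c ∧ (r = key ∨ r = ghostDoor) := by
  revert l c r
  decide

theorem rule_eq_key {l c r : PacmanCell} (h : rule l c r = key) :
    ¬ IsDoor c ∧ (r = key ∨ (IsDoor r ∧ (l = pacman ∨ c = pacman))) := by
  revert l c r
  decide

theorem rule_eq_pacman {l c r : PacmanCell} (h : rule l c r = pacman) :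
    ¬ IsDoor c ∧ ((l = pacman ∧ ¬ IsDoor r) ∨ (IsDoor l ∧ (c = ghost ∨ r = ghost))) := by
  revert l c r
  decide

theorem rule_pacman_mid {l r : PacmanCell} (h : rule l pacman r = ghost) : False := by
  revert l r
  decide

theorem quiet_rule {l c r : PacmanCell} (hl : Quiet l ∨ IsDoor l) (hc : Quiet c) (hr : Quiet r) :
    Quiet (rule l c r) := by
  revert l c r
  decide

theorem quiet_rule_of_left {l c r : PacmanCell} (hl : l ≠ pacman) (hc : Quiet c) (hr : Quiet r) :
    Quiet (rule l c r) := by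
  revert l c r
  decide

theorem not_quiet_rule_of_right {l c r : PacmanCell} (hr : r = key ∨ r = ghostDoor)
    (hl : Quiet l ∨ IsDoor l) (hc : Quiet c) : ¬ Quiet (rule l c r) := by
  revert l c r
  decide

theorem quiet_rule_mid {l c r : PacmanCell} (hc : c = key ∨ c = ghostDoor) (hl : Quiet l)
    (hr : Quiet r) : Quiet (rule l c r) := by
  revert l c r
  decide

theorem rule_ghost_of_isDoor {l c r : PacmanCell} (hc : IsDoor c) :
    Quiet (rule l c ghost) ∧ ¬ Quiet (rule c ghost r) := by
  revert l c r
  decide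

theorem rule_ghost_of_not_isDoor {l c r : PacmanCell} (hl : Quiet l ∨ IsDoor l) (hc : Quiet c)
    (hc' : ¬ IsDoor c) (hr : Quiet r) :
    ¬ Quiet (rule l c ghost) ∧ Quiet (rule c ghost r) := by
  revert l c r
  decide

theorem quiet_rule_pacman_right {l c : PacmanCell} (hl : Quiet l ∨ IsDoor l) (hc : Quiet c) :
    Quiet (rule l c pacman) := by
  revert l c
  decide

theorem rule_pacman_of_isDoor {l c r : PacmanCell} (hc : IsDoor c) (hr : Quiet r) :
    ¬ Quiet (rule l pacman c) ∧ Quiet (rule pacman c r) := by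
  revert l c r
  decide

theorem rule_pacman_of_not_isDoor {l c r : PacmanCell} (hl : Quiet l) (hc : ¬ IsDoor c) :
    Quiet (rule l pacman c) ∧ ¬ Quiet (rule pacman c r) := by
  revert l c r
  decide

end PacmanCell

/-! ### The metric and cylinder sets -/

namespace FullShift

theorem eq_of_dist_lt {A : Type*} {x y : FullShift A} {k : ℕ}
    (h : dist x y < (1 / 2 : ℝ) ^ k) {j : ℤ} (hj : j.natAbs ≤ k) : x j = y j := by
  by_contra hne
  have h1 : (1 / 2 : ℝ) ^ j.natAbs ≤ dist x y := le_shiftDist_of_ne hne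
  have h2 : (1 / 2 : ℝ) ^ k ≤ (1 / 2 : ℝ) ^ j.natAbs :=
    pow_le_pow_of_le_one (by norm_num) (by norm_num) hj
  linarith

theorem dist_le_of_agree {A : Type*} {x y : FullShift A} {k : ℕ}
    (h : ∀ j : ℤ, j.natAbs < k → x j = y j) : dist x y ≤ (1 / 2 : ℝ) ^ k :=
  shiftDist_le_of_agree h

theorem dist_le_one {A : Type*} (x y : FullShift A) : dist x y ≤ 1 := by
  simpa using dist_le_of_agree (x := x) (y := y) (k := 0) (by simp)

theorem one_le_dist {A : Type*} {x y : FullShift A} (h : x 0 ≠ y 0) : 1 ≤ dist x y := by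
  have h1 : (1 / 2 : ℝ) ^ (0 : ℤ).natAbs ≤ dist x y := le_shiftDist_of_ne h
  simpa using h1

theorem exists_agree_subset {A : Type*} {U : Set (FullShift A)} (hU : IsOpen U)
    {x : FullShift A} (hx : x ∈ U) :
    ∃ m : ℕ, ∀ y : FullShift A, (∀ j : ℤ, j.natAbs < m → y j = x j) → y ∈ U := by
  obtain ⟨ε, hε, hb⟩ := Metric.isOpen_iff.mp hU x hx
  obtain ⟨k, hk⟩ := exists_pow_lt_of_lt_one hε (by norm_num : (1 / 2 : ℝ) < 1)
  exact ⟨k, fun y hy => hb ((dist_le_of_agree hy).trans_lt hk)⟩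

end FullShift

open PacmanCell

/-! ### The automaton and its immobile doors -/

theorem continuous_pacmanCA : Continuous pacmanCA := by
  rw [Metric.continuous_iff]
  intro x ε hε
  obtain ⟨k, hk⟩ := exists_pow_lt_of_lt_one hε (by norm_num : (1 / 2 : ℝ) < 1)
  refine ⟨(1 / 2 : ℝ) ^ k, by positivity, fun y hy => ?_⟩
  refine (FullShift.dist_le_of_agree (k := k) fun j hj => ?_).trans_lt hk
  have h (i : ℤ) (hi : i.natAbs ≤ k) : y i = x i := FullShift.eq_of_dist_lt hy hi
  change rule _ _ _ = rule _ _ _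
  rw [h (j - 1) (by omega), h j (by omega), h (j + 1) (by omega)]

theorem isCellularAutomaton_pacmanCA : FullShift.IsCellularAutomaton pacmanCA := by
  refine ⟨continuous_pacmanCA, ?_⟩
  funext x i
  change rule (x (i + 1 - 1)) (x (i + 1)) (x (i + 1 + 1)) =
    rule (x (i - 1 + 1)) (x (i + 1)) (x (i + 1 + 1))
  rw [show i + 1 - 1 = i - 1 + 1 by ring]

theorem isDoor_pacmanCA (x : FullShift PacmanCell) (i : ℤ) :
    IsDoor (pacmanCA x i) ↔ IsDoor (x i) :=
  isDoor_rule_iff _ _ _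

theorem isDoor_iterate (x : FullShift PacmanCell) (n : ℕ) (i : ℤ) :
    IsDoor (pacmanCA^[n] x i) ↔ IsDoor (x i) := by
  induction n with
  | zero => rfl
  | succ n ih => rw [Function.iterate_succ_apply', isDoor_pacmanCA, ih]

theorem iterate_succ_cell (x : FullShift PacmanCell) (n : ℕ) (i : ℤ) :
    pacmanCA^[n + 1] x i =
      rule (pacmanCA^[n] x (i - 1)) (pacmanCA^[n] x i) (pacmanCA^[n] x (i + 1)) := by
  rw [Function.iterate_succ_apply']
  rfl

/-- No information crosses a door from left to right. -/
theorem iterate_agree_right {q : ℤ} {x y : FullShift PacmanCell} (hx : IsDoor (x q))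
    (hy : IsDoor (y q)) (h : ∀ j, q < j → x j = y j) (n : ℕ) :
    ∀ j, q < j → pacmanCA^[n] x j = pacmanCA^[n] y j := by
  -- As a left neighbour, either door symbol has the same effect.
  have key : ∀ l l' c r, IsDoor l → IsDoor l' → rule l c r = rule l' c r := by decide
  induction n with
  | zero => exact h
  | succ n ih =>
    intro j hj
    rw [iterate_succ_cell, iterate_succ_cell, ← ih j hj, ← ih (j + 1) (by omega)]
    rcases eq_or_ne (j - 1) q with hq | hq
    · rw [hq]
      exact key _ _ _ _ ((isDoor_iterate x n q).2 hx) ((isDoor_iterate y n q).2 hy)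
    · rw [ih (j - 1) (by omega)]

/-! ### The potential of a particle -/

open Classical in
/-- The number of doors in `[q, i)`. -/
noncomputable def doorCount (x : FullShift PacmanCell) (q i : ℤ) : ℕ :=
  ((Finset.Ico q i).filter fun j => IsDoor (x j)).card

open Classical in
theorem doorCount_succ (x : FullShift PacmanCell) {q i : ℤ} (h : q ≤ i) :
    doorCount x q (i + 1) = doorCount x q i + if IsDoor (x i) then 1 else 0 := by
  have : Finset.Ico q (i + 1) = insert i (Finset.Ico q i) := by
    ext j
    simp only [Finset.mem_insert, Finset.mem_Ico]
    omega
  unfold doorCount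
  rw [this, Finset.filter_insert]
  split_ifs
  · rw [Finset.card_insert_of_notMem (by simp)]
  · rfl

open Classical in
theorem doorCount_pacmanCA (x : FullShift PacmanCell) (q i : ℤ) :
    doorCount (pacmanCA x) q i = doorCount x q i := by
  exact congrArg Finset.card (Finset.filter_congr fun j _ => isDoor_pacmanCA x j)

open Classical in
theorem doorCount_le (x : FullShift PacmanCell) (q i : ℤ) : doorCount x q i ≤ (i - q).toNat := by
  simpa [doorCount] using Finset.card_filter_le (Finset.Ico q i) fun j => IsDoor (x j)

/-- The progress of a particle within its compartment, which is at relative position `i` in a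
region of length `K`. -/
def compartmentPotential (K i : ℤ) : PacmanCell → ℤ
  | .key => i
  | .pacman => 2 * K + 1 - i
  | .ghost => 2 * K + 2 + i
  | .ghostDoor => 2 * K + 2 + i
  | _ => 0

/-- A bound for the time that the particle at `i` needs to leave the region `(q, q + K]` to the
left if it is not eaten. -/
noncomputable def potential (q K : ℤ) (x : FullShift PacmanCell) (i : ℤ) : ℤ :=
  doorCount x q i * (3 * K + 3) + compartmentPotential K (i - q) (x i)

theorem potential_nonneg {q K i : ℤ} (x : FullShift PacmanCell) (hi : q < i) (hK : i ≤ q + K) :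
    0 ≤ potential q K x i := by
  unfold potential
  have h1 : 0 ≤ (doorCount x q i : ℤ) * (3 * K + 3) :=
    mul_nonneg (by positivity) (by omega)
  have h2 : 0 ≤ compartmentPotential K (i - q) (x i) := by
    cases x i <;> simp only [compartmentPotential] <;> omega
  omega

/-- At most `K` doors lie left of the particle within the region, and the compartment term stays
below the weight `3 * K + 3` of one door. -/
theorem potential_le {q K i : ℤ} (x : FullShift PacmanCell) (hi : q < i) (hK : i ≤ q + K) :
    potential q K x i ≤ (K + 1) * (3 * K + 3) := by
  unfold potential
  have h0 := doorCount_le x q i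
  have h1 : (doorCount x q i : ℤ) * (3 * K + 3) ≤ K * (3 * K + 3) :=
    mul_le_mul_of_nonneg_right (by omega) (by omega)
  have h2 : compartmentPotential K (i - q) (x i) ≤ 3 * K + 3 := by
    cases x i <;> simp only [compartmentPotential] <;> omega
  linarith

/-- Every particle comes from a neighbouring particle of larger potential. -/
theorem exists_parent {q K i : ℤ} {x : FullShift PacmanCell} (hq : IsDoor (x q)) (hi : q < i)
    (hK : i ≤ q + K) (h : ¬ Quiet (pacmanCA x i)) :
    ∃ j, q < j ∧ j ≤ i + 1 ∧ ¬ Quiet (x j) ∧ potential q K (pacmanCA x) i < potential q K x j ∧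
      (IsDoor (x i) → j = i + 1 ∧ (x j = key ∨ x j = ghostDoor)) := by
  -- A pacman cannot stand on the door `q`, so a parent to the left is still inside the region.
  have hp : ∀ j, x j = pacman → q ≤ j → q < j := fun j hj hle =>
    lt_of_le_of_ne hle fun he => by
      rw [← he] at hj
      rw [hj] at hq
      revert hq
      decide
  have hs := doorCount_succ x hi.le
  have hs' := doorCount_succ x (show q ≤ i - 1 by omega)
  rw [sub_add_cancel] at hs'
  have hT : pacmanCA x i = rule (x (i - 1)) (x i) (x (i + 1)) := rfl
  unfold potential
  rw [doorCount_pacmanCA]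
  cases hv : pacmanCA x i with
  | empty => exact absurd (Or.inl hv) h
  | door => exact absurd (Or.inr hv) h
  | ghost =>
    obtain ⟨hc, hr⟩ := rule_eq_ghost (hT ▸ hv)
    refine ⟨i + 1, by omega, le_rfl, by rcases hr with hr | hr <;> rw [hr] <;> decide, ?_,
      fun hd => absurd hd hc⟩
    rw [hs, if_neg hc]
    rcases hr with hr | hr <;> rw [hr] <;> simp only [compartmentPotential] <;> push_cast <;>
      linarith
  | ghostDoor =>
    obtain ⟨hc, hr⟩ := rule_eq_ghostDoor (hT ▸ hv)
    refine ⟨i + 1, by omega, le_rfl, by rcases hr with hr | hr <;> rw [hr] <;> decide, ?_,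
      fun _ => ⟨rfl, hr⟩⟩
    -- The only case in which a door is crossed: the loss of `3 * K + 3` outweighs the restart of
    -- the compartment term near `2 * K + 2`.
    rw [hs, if_pos hc]
    rcases hr with hr | hr <;> rw [hr] <;> simp only [compartmentPotential] <;> push_cast <;>
      linarith
  | key =>
    obtain ⟨hc, hr | ⟨-, hr | hr⟩⟩ := rule_eq_key (hT ▸ hv)
    · refine ⟨i + 1, by omega, le_rfl, by rw [hr]; decide, ?_, fun hd => absurd hd hc⟩
      rw [hs, if_neg hc, hr]
      simp only [compartmentPotential]
      push_cast
      linarith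
    · have hd : ¬ IsDoor (x (i - 1)) := by rw [hr]; decide
      refine ⟨i - 1, hp _ hr (by omega), by omega, by rw [hr]; decide, ?_,
        fun hd => absurd hd hc⟩
      rw [hs', if_neg hd, hr]
      simp only [compartmentPotential]
      push_cast
      linarith
    · refine ⟨i, hi, by omega, by rw [hr]; decide, ?_, fun hd => absurd hd hc⟩
      rw [hr]
      simp only [compartmentPotential]
      linarith
  | pacman =>
    obtain ⟨hc, ⟨hr, -⟩ | ⟨-, hr | hr⟩⟩ := rule_eq_pacman (hT ▸ hv)
    · have hd : ¬ IsDoor (x (i - 1)) := by rw [hr]; decide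
      refine ⟨i - 1, hp _ hr (by omega), by omega, by rw [hr]; decide, ?_,
        fun hd => absurd hd hc⟩
      rw [hs', if_neg hd, hr]
      simp only [compartmentPotential]
      push_cast
      linarith
    · refine ⟨i, hi, by omega, by rw [hr]; decide, ?_, fun hd => absurd hd hc⟩
      rw [hr]
      simp only [compartmentPotential]
      linarith
    · refine ⟨i + 1, by omega, le_rfl, by rw [hr]; decide, ?_, fun hd => absurd hd hc⟩
      rw [hs, if_neg hc, hr]
      simp only [compartmentPotential]
      push_cast
      linarith

/-- Iterating `exists_parent` backwards in time gains at least 1 in potential per step. The ancestry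
could leave the region only through the door `a`, and then its parent would be one of the particles
at `a + 1` that `hin` forbids. -/
theorem exists_ancestor {q a : ℤ} {x : FullShift PacmanCell} (hq : IsDoor (x q))
    (ha : IsDoor (x a)) (n : ℕ)
    (hin : ∀ u < n, pacmanCA^[u] x (a + 1) ≠ key ∧ pacmanCA^[u] x (a + 1) ≠ ghostDoor) :
    ∀ i, q < i → i ≤ a → ¬ Quiet (pacmanCA^[n] x i) →
      ∃ j, q < j ∧ j ≤ a ∧ potential q (a - q) (pacmanCA^[n] x) i + n ≤ potential q (a - q) x j := by
  induction n with
  | zero => exact fun i h1 h2 _ => ⟨i, h1, h2, by simp⟩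
  | succ n ih =>
    intro i h1 h2 h
    rw [Function.iterate_succ_apply'] at h ⊢
    obtain ⟨j, hj, hji, hjq, hpot, hd⟩ :=
      exists_parent (K := a - q) ((isDoor_iterate x n q).2 hq) h1 (by omega) h
    have hja : j ≤ a := by
      by_contra hlt
      have hia : i = a := by omega
      obtain ⟨rfl, hk⟩ := hd (hia ▸ (isDoor_iterate x n a).2 ha)
      rw [hia] at hk
      exact hk.elim (hin n (by omega)).1 (hin n (by omega)).2
    obtain ⟨j', h3, h4, h5⟩ := ih (fun u hu => hin u (by omega)) j hj hja hjq
    refine ⟨j', h3, h4, ?_⟩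
    push_cast
    linarith

/-- The time in which a region of length `K` becomes quiet. -/
def evacuationTime (K : ℕ) : ℕ := (K + 1) * (3 * K + 3) + 1

/-- If no particle enters at the door `a`, then the region `(q, a]` becomes quiet. -/
theorem quiet_of_no_input {q a : ℤ} {x : FullShift PacmanCell} (hq : IsDoor (x q))
    (ha : IsDoor (x a)) {n : ℕ} (hn : evacuationTime (a - q).toNat ≤ n)
    (hin : ∀ u < n, pacmanCA^[u] x (a + 1) ≠ key ∧ pacmanCA^[u] x (a + 1) ≠ ghostDoor)
    {i : ℤ} (h1 : q < i) (h2 : i ≤ a) : Quiet (pacmanCA^[n] x i) := by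
  by_contra h
  obtain ⟨j, h3, h4, h5⟩ := exists_ancestor hq ha n hin i h1 h2 h
  have h6 := potential_le (K := a - q) x h3 (by omega)
  have h7 := potential_nonneg (K := a - q) (pacmanCA^[n] x) h1 (by omega)
  have h8 : ((evacuationTime (a - q).toNat : ℕ) : ℤ) =
      (a - q + 1) * (3 * (a - q) + 3) + 1 := by
    unfold evacuationTime
    push_cast
    rw [Int.toNat_of_nonneg (by omega)]
  have h9 : ((evacuationTime (a - q).toNat : ℕ) : ℤ) ≤ n := by exact_mod_cast hn
  linarith

/-! ### The motion of a single particle -/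

/-- Right of `q` the only particle is that at `i`. -/
def IsSingleParticle (q : ℤ) (x : FullShift PacmanCell) (i : ℤ) : Prop :=
  q < i ∧ ¬ Quiet (x i) ∧ ∀ j, q < j → j ≠ i → Quiet (x j)

/-- With no other particle present nothing can be eaten, and no case of the rule duplicates a
particle. It moves by at most one cell, and only a pacman moves right. -/
theorem IsSingleParticle.step {q a i : ℤ} {x : FullShift PacmanCell} (hq : IsDoor (x q))
    (ha : IsDoor (x a)) (hx : IsSingleParticle q x i) (hi : q + 1 < i)
    (hia : i ≤ a ∨ (i = a + 1 ∧ x i = key)) :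
    ∃ i', i - 1 ≤ i' ∧ i' ≤ a ∧ IsSingleParticle q (pacmanCA x) i' := by
  obtain ⟨-, hxi, hquiet⟩ := hx
  have hT (j : ℤ) : pacmanCA x j = rule (x (j - 1)) (x j) (x (j + 1)) := rfl
  have hleft (j : ℤ) (h1 : q < j) (h2 : j - 1 ≠ i) : Quiet (x (j - 1)) ∨ IsDoor (x (j - 1)) := by
    rcases eq_or_ne (j - 1) q with h | h
    · exact Or.inr (h ▸ hq)
    · exact Or.inl (hquiet _ (by omega) h2)
  have hfar (j : ℤ) (h1 : q < j) (h2 : j ≠ i - 1) (h3 : j ≠ i) (h4 : j ≠ i + 1) :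
      Quiet (pacmanCA x j) :=
    quiet_rule (hleft j h1 (by omega)) (hquiet j h1 h3) (hquiet _ (by omega) (by omega))
  have hL := hleft (i - 1) (by omega) (by omega)
  have hl : Quiet (x (i - 1)) := hquiet _ (by omega) (by omega)
  have hr : Quiet (x (i + 1)) := hquiet _ (by omega) (by omega)
  have hrr : Quiet (x (i + 1 + 1)) := hquiet _ (by omega) (by omega)
  have h0 : pacmanCA x (i - 1) = rule (x (i - 1 - 1)) (x (i - 1)) (x i) := by
    rw [hT, sub_add_cancel]
  have h1 : pacmanCA x i = rule (x (i - 1)) (x i) (x (i + 1)) := rfl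
  have h2 : pacmanCA x (i + 1) = rule (x i) (x (i + 1)) (x (i + 1 + 1)) := by
    rw [hT, add_sub_cancel_right]
  have hright (h : x i ≠ pacman) : Quiet (pacmanCA x (i + 1)) := by
    rw [h2]
    exact quiet_rule_of_left h hr hrr
  have hcarry (h : x i = key ∨ x i = ghostDoor) :
      IsSingleParticle q (pacmanCA x) (i - 1) := by
    refine ⟨by omega, ?_, fun j hj hne => ?_⟩
    · rw [h0]
      exact not_quiet_rule_of_right h hL hl
    · by_cases hj1 : j = i
      · rw [hj1, h1]
        exact quiet_rule_mid h hl hr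
      by_cases hj2 : j = i + 1
      · rw [hj2]
        exact hright (by rcases h with h | h <;> rw [h] <;> decide)
      exact hfar j hj hne hj1 hj2
  cases hv : x i with
  | empty => exact absurd (Or.inl hv) hxi
  | door => exact absurd (Or.inr hv) hxi
  | key => exact ⟨i - 1, le_rfl, by omega, hcarry (Or.inl hv)⟩
  | ghostDoor => exact ⟨i - 1, le_rfl, by omega, hcarry (Or.inr hv)⟩
  | ghost =>
    have hia' : i ≤ a := hia.resolve_right fun h => by rw [hv] at h; exact absurd h.2 (by decide)
    have hr' := hright (by rw [hv]; decide)
    rw [hv] at h0 h1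
    by_cases hd : IsDoor (x (i - 1))
    · refine ⟨i, by omega, hia', by omega, ?_, fun j hj hne => ?_⟩
      · rw [h1]
        exact (rule_ghost_of_isDoor (l := empty) hd).2
      · by_cases hj1 : j = i - 1
        · rw [hj1, h0]
          exact (rule_ghost_of_isDoor (r := empty) hd).1
        by_cases hj2 : j = i + 1
        · rwa [hj2]
        exact hfar j hj hj1 hne hj2
    · have hg := rule_ghost_of_not_isDoor hL hl hd hr
      refine ⟨i - 1, le_rfl, by omega, by omega, ?_, fun j hj hne => ?_⟩
      · rw [h0]
        exact hg.1
      · by_cases hj1 : j = i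
        · rw [hj1, h1]
          exact hg.2
        by_cases hj2 : j = i + 1
        · rwa [hj2]
        exact hfar j hj hne hj1 hj2
  | pacman =>
    have hia' : i ≤ a := hia.resolve_right fun h => by rw [hv] at h; exact absurd h.2 (by decide)
    -- A pacman is never on a door, so moving right by one cannot take it past `a`.
    have hne_a : i ≠ a := by
      rintro rfl
      rw [hv] at ha
      revert ha
      decide
    rw [hv] at h0 h1 h2
    have hl' : Quiet (pacmanCA x (i - 1)) := by
      rw [h0]
      exact quiet_rule_pacman_right hL hl
    by_cases hd : IsDoor (x (i + 1))
    · have hg := rule_pacman_of_isDoor (l := x (i - 1)) hd hrr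
      refine ⟨i, by omega, hia', by omega, ?_, fun j hj hne => ?_⟩
      · rw [h1]
        exact hg.1
      · by_cases hj1 : j = i - 1
        · rwa [hj1]
        by_cases hj2 : j = i + 1
        · rw [hj2, h2]
          exact hg.2
        exact hfar j hj hj1 hne hj2
    · have hg := rule_pacman_of_not_isDoor (r := x (i + 1 + 1)) hl hd
      refine ⟨i + 1, by omega, by omega, by omega, ?_, fun j hj hne => ?_⟩
      · rw [h2]
        exact hg.2
      · by_cases hj1 : j = i - 1
        · rwa [hj1]
        by_cases hj2 : j = i
        · rw [hj2, h1]
          exact hg.1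
        exact hfar j hj hj1 hj2 hne

/-- A single particle right of the origin eventually reaches the origin. -/
theorem IsSingleParticle.exists_reaches_zero {q a : ℤ} (hq0 : q < 0) (n : ℕ) :
    ∀ (x : FullShift PacmanCell) (i : ℤ), IsDoor (x q) → IsDoor (x a) → 0 ≤ i →
      IsSingleParticle q x i → (i ≤ a ∨ (i = a + 1 ∧ x i = key)) →
      potential q (a + 1 - q) x i < n → ∃ τ : ℕ, ¬ Quiet (pacmanCA^[τ] x 0) := by
  induction n with
  | zero =>
    intro x i _ _ _ hx hia hn
    have := potential_nonneg (K := a + 1 - q) x hx.1 (by omega)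
    push_cast at hn
    omega
  | succ n ih =>
    intro x i hq ha hi hx hia hn
    rcases hi.eq_or_lt with rfl | hpos
    · exact ⟨0, hx.2.1⟩
    obtain ⟨i', h1, h2, h3⟩ := hx.step hq ha (by omega) hia
    obtain ⟨j, hj, -, hjq, hpot, -⟩ :=
      exists_parent (K := a + 1 - q) hq h3.1 (by omega) h3.2.1
    -- The parent must be the only particle there is, so the potential really drops. Leftward moves
    -- have length one, so the origin cannot be skipped.
    have hji : j = i := by
      by_contra hne
      exact hjq (hx.2.2 j hj hne)
    subst hji
    obtain ⟨τ, hτ⟩ := ih (pacmanCA x) i' ((isDoor_pacmanCA x q).2 hq)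
      ((isDoor_pacmanCA x a).2 ha) (by omega) h3 (Or.inl h2) (by push_cast at hn; omega)
    exact ⟨τ + 1, by rwa [Function.iterate_succ_apply]⟩

/-! ### Cofinite sensitivity -/

/-- In empty space a keymaster moves left at unit speed. Influence from the left would need a pacman
at `a`, where there is a door. -/
theorem key_travels {a : ℤ} {x : FullShift PacmanCell} {s : ℕ} (ha : IsDoor (x a))
    (hx : ∀ j, a < j → x j = if j = a + 1 + s then key else empty) {t : ℕ} (ht : t ≤ s) :
    ∀ j, a < j → pacmanCA^[t] x j = if j + t = a + 1 + s then key else empty := by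
  have local1 : ∀ l, l ≠ pacman → rule l empty empty = empty ∧ rule l key empty = empty ∧
      rule l empty key = key := by decide
  induction t with
  | zero => simpa using hx
  | succ t ih =>
    intro j hj
    have ih := ih (by omega)
    have hl : pacmanCA^[t] x (j - 1) ≠ pacman := by
      rcases eq_or_ne (j - 1) a with h | h
      · intro he
        have := (isDoor_iterate x t a).2 ha
        rw [← h, he] at this
        revert this
        decide
      · rw [ih (j - 1) (by omega)]
        split_ifs <;> decide
    obtain ⟨l1, l2, l3⟩ := local1 _ hl
    rw [iterate_succ_cell, ih j hj, ih (j + 1) (by omega)]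
    push_cast
    by_cases h1 : j + t = a + 1 + s
    · rw [if_pos h1, if_neg (by omega), if_neg (by omega), l2]
    · by_cases h2 : j + (t + 1) = a + 1 + s
      · rw [if_neg h1, if_pos (by omega), if_pos h2, l3]
      · rw [if_neg h1, if_neg (by omega), if_neg h2, l1]

theorem empty_stays {a : ℤ} {x : FullShift PacmanCell} (ha : IsDoor (x a))
    (hx : ∀ j, a < j → x j = empty) (t : ℕ) : ∀ j, a < j → pacmanCA^[t] x j = empty := by
  have hrule : ∀ l, l ≠ pacman → rule l empty empty = empty := by decide
  induction t with
  | zero => exact hx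
  | succ t ih =>
    intro j hj
    rw [iterate_succ_cell, ih j hj, ih (j + 1) (by omega)]
    refine hrule _ fun he => ?_
    rcases eq_or_ne (j - 1) a with h | h
    · have := (isDoor_iterate x t a).2 ha
      rw [← h, he] at this
      revert this
      decide
    · rw [ih (j - 1) (by omega)] at he
      revert he
      decide

/-- The configuration that agrees with `x` on `(-m, m)`, has doors at `±m`, and agrees with `z`
elsewhere. -/
def framed (x : FullShift PacmanCell) (m : ℕ) (z : FullShift PacmanCell) : FullShift PacmanCell :=
  fun j => if j.natAbs < m then x j else if j.natAbs = m then door else z j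

/-- One configuration sends a keymaster into the window, timed to be at the origin at time `n`; the
other has nothing outside, so its window is quiet by then. -/
theorem exists_separated (x : FullShift PacmanCell) {m : ℕ} (hm : 0 < m) :
    ∃ N : ℕ, ∀ n ≥ N, ∃ y y' : FullShift PacmanCell,
      (∀ j : ℤ, j.natAbs < m → y j = x j) ∧ (∀ j : ℤ, j.natAbs < m → y' j = x j) ∧
      pacmanCA^[n] y 0 ≠ pacmanCA^[n] y' 0 := by
  classical
  have hdoor (z : FullShift PacmanCell) (j : ℤ) (hj : j.natAbs = m) :
      framed x m z j = door := by
    unfold framed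
    rw [if_neg (by omega), if_pos hj]
  have hinner (z : FullShift PacmanCell) (j : ℤ) (hj : j.natAbs < m) : framed x m z j = x j := by
    unfold framed
    rw [if_pos hj]
  have houter (z : FullShift PacmanCell) (j : ℤ) (hj : (m : ℤ) < j) : framed x m z j = z j := by
    unfold framed
    rw [if_neg (by omega), if_neg (by omega)]
  have hDoor (z : FullShift PacmanCell) (j : ℤ) (hj : j.natAbs = m) :
      IsDoor (framed x m z j) := Or.inl (hdoor z j hj)
  let e : FullShift PacmanCell := fun _ => empty
  -- The state on arrival: the doors of the framed configuration and one keymaster about to enter.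
  -- It does not involve the travel time `s`, hence neither does `τ`.
  let z : FullShift PacmanCell := fun j =>
    if j = m + 1 then key else if IsDoor (framed x m e j) then door else empty
  have hzq : IsDoor (z (-m)) := by
    change IsDoor (if _ then _ else _)
    rw [if_neg (by omega), if_pos (hDoor e _ (by omega))]
    exact Or.inl rfl
  have hza : IsDoor (z m) := by
    change IsDoor (if _ then _ else _)
    rw [if_neg (by omega), if_pos (hDoor e _ (by omega))]
    exact Or.inl rfl
  have hz1 : z (m + 1) = key := if_pos rfl
  have hz : IsSingleParticle (-m) z (m + 1) := by
    refine ⟨by omega, by rw [hz1]; decide, fun j _ hne => ?_⟩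
    change Quiet (if _ then _ else _)
    rw [if_neg hne]
    split_ifs
    · exact Or.inr rfl
    · exact Or.inl rfl
  obtain ⟨τ, hτ⟩ := hz.exists_reaches_zero (a := m) (by omega)
    (potential (-m) (m + 1 - -m) z (m + 1) + 1).toNat z (m + 1) hzq hza (by omega)
    (Or.inr ⟨rfl, hz1⟩) (by omega)
  refine ⟨evacuationTime ((m : ℤ) - -m).toNat + τ, fun n hn => ?_⟩
  obtain ⟨s, rfl⟩ : ∃ s, n = τ + s := ⟨n - τ, by omega⟩
  let y : FullShift PacmanCell := framed x m fun j => if j = m + 1 + s then key else empty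
  have hy {t : ℕ} (ht : t ≤ s) := key_travels (x := y) (a := m) (s := s) (hDoor _ _ (by omega))
    (fun j hj => houter _ j hj) ht
  have hy' := empty_stays (x := framed x m e) (a := m) (hDoor _ _ (by omega))
    (fun j hj => houter _ j hj)
  have hquiet : Quiet (pacmanCA^[τ + s] (framed x m e) 0) := by
    refine quiet_of_no_input (hDoor e (-m) (by omega)) (hDoor e m (by omega)) (by omega)
      (fun u _ => ?_) (by omega) (by omega)
    rw [hy' u _ (by omega)]
    decide
  -- During the `s` steps of travel the window empties, and a quiet cell is determined by whether it
  -- is a door.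
  have hyz : ∀ j, (-m : ℤ) < j → pacmanCA^[s] y j = z j := by
    intro j hj
    change _ = if _ then _ else _
    rcases le_or_gt j m with hjm | hjm
    · have hq : Quiet (pacmanCA^[s] y j) := by
        refine quiet_of_no_input (q := -m) (a := m) (hDoor _ _ (by omega)) (hDoor _ _ (by omega))
          (by omega) (fun u hu => ?_) hj hjm
        rw [hy hu.le _ (by omega), if_neg (by omega)]
        decide
      have hd : IsDoor (pacmanCA^[s] y j) ↔ IsDoor (framed x m e j) := by
        rw [isDoor_iterate]
        rcases lt_or_eq_of_le (show j.natAbs ≤ m by omega) with h | h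
        · rw [hinner e j h]
          exact iff_of_eq (congrArg IsDoor (hinner _ j h))
        · exact iff_of_true (hDoor _ j h) (hDoor _ j h)
      have hcases : ∀ v, Quiet v → v = if IsDoor v then door else empty := by decide
      rw [if_neg (by omega), hcases _ hq]
      simp only [← hd]
    · have hnd : ¬ IsDoor (framed x m e j) := by
        rw [houter e j hjm]
        change ¬ IsDoor empty
        decide
      rw [hy le_rfl j hjm, if_neg hnd]
      simp only [add_left_inj]
  refine ⟨y, framed x m e, hinner _, hinner _, fun heq => hτ ?_⟩
  rw [← heq, Function.iterate_add_apply, iterate_agree_right (y := z) (q := -m)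
    ((isDoor_iterate _ _ _).2 (hDoor _ _ (by omega))) hzq hyz τ 0 (by omega)] at hquiet
  exact hquiet

/-! ### Diameters of images of open sets -/

theorem exists_one_le_diam {U : Set (FullShift PacmanCell)} (hU : IsOpen U) (hne : U.Nonempty) :
    ∃ N : ℕ, ∀ n ≥ N, 1 ≤ Metric.diam (pacmanCA^[n] '' U) := by
  obtain ⟨x, hx⟩ := hne
  obtain ⟨m, hm⟩ := FullShift.exists_agree_subset hU hx
  obtain ⟨N, hN⟩ := exists_separated x (m := m + 1) (by omega)
  refine ⟨N, fun n hn => ?_⟩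
  obtain ⟨y, y', hy, hy', hd⟩ := hN n hn
  have hyU := hm y fun j hj => hy j (by omega)
  have hyU' := hm y' fun j hj => hy' j (by omega)
  exact (FullShift.one_le_dist hd).trans (Metric.dist_le_diam_of_mem
    (isCompact_univ.isBounded.subset (Set.subset_univ _))
    (Set.mem_image_of_mem _ hyU) (Set.mem_image_of_mem _ hyU'))

theorem cofinitelySensitive_pacmanCA : MeanDynamics.CofinitelySensitive pacmanCA := by
  refine ⟨1 / 2, by norm_num, fun U hU hne => ?_⟩
  obtain ⟨N, hN⟩ := exists_one_le_diam hU hne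
  refine (Set.finite_lt_nat N).subset fun n hn => ?_
  by_contra hlt
  have h1 := hN n (not_lt.mp hlt)
  refine hn ?_
  change (1 / 2 : ℝ) < _
  linarith

theorem eventually_lt_diamAverage (x : FullShift PacmanCell) {δ : ℝ} (hδ : 0 < δ) :
    ∀ᶠ n : ℕ in Filter.atTop,
      1 / 2 < MeanDynamics.diamAverage pacmanCA (Metric.ball x δ) n := by
  obtain ⟨N, hN⟩ := exists_one_le_diam Metric.isOpen_ball ⟨x, Metric.mem_ball_self hδ⟩
  -- Past `2 * N`, more than half of the summands have index above `N`, and each of these is at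
  -- least 1.
  filter_upwards [Filter.eventually_gt_atTop (2 * N)] with n hn
  have h1 : ((n - N : ℕ) : ℝ) ≤
      ∑ i ∈ Finset.Icc 1 n, Metric.diam (pacmanCA^[i] '' Metric.ball x δ) := by
    calc ((n - N : ℕ) : ℝ) = ∑ i ∈ Finset.Icc (N + 1) n, (1 : ℝ) := by simp
      _ ≤ ∑ i ∈ Finset.Icc (N + 1) n, Metric.diam (pacmanCA^[i] '' Metric.ball x δ) :=
        Finset.sum_le_sum fun i hi => hN i (by simp only [Finset.mem_Icc] at hi; omega)
      _ ≤ _ := Finset.sum_le_sum_of_subset_of_nonneg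
        (Finset.Icc_subset_Icc (by omega) le_rfl) fun _ _ _ => Metric.diam_nonneg
  have hn' : (2 * N : ℝ) < n := by exact_mod_cast hn
  have hn0 : (0 : ℝ) < n := lt_of_le_of_lt (by positivity) hn'
  rw [Nat.cast_sub (by omega)] at h1
  unfold MeanDynamics.diamAverage
  rw [lt_div_iff₀ hn0]
  linarith

theorem diamAverage_le_one (U : Set (FullShift PacmanCell)) (n : ℕ) :
    MeanDynamics.diamAverage pacmanCA U n ≤ 1 := by
  unfold MeanDynamics.diamAverage
  refine div_le_one_of_le₀ ?_ (Nat.cast_nonneg n)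
  calc _ ≤ ∑ i ∈ Finset.Icc 1 n, (1 : ℝ) := Finset.sum_le_sum fun i _ =>
        Metric.diam_le_of_forall_dist_le zero_le_one fun _ _ _ _ => FullShift.dist_le_one _ _
    _ = n := by simp

theorem diamMeanEquicontinuityPoints_pacmanCA :
    MeanDynamics.diamMeanEquicontinuityPoints pacmanCA = ∅ := by
  refine Set.eq_empty_of_forall_notMem fun x hx => ?_
  obtain ⟨δ, hδ, hlim⟩ := hx (1 / 2) (by norm_num)
  have h1 := Filter.eventually_lt_of_limsup_lt hlim
    (Filter.isBoundedUnder_of ⟨1, fun n => diamAverage_le_one _ n⟩)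
  obtain ⟨n, h2, h3⟩ := (h1.and (eventually_lt_diamAverage x hδ)).exists
  linarith

theorem not_almostDiamMeanEquicontinuous_pacmanCA :
    ¬ MeanDynamics.AlmostDiamMeanEquicontinuous pacmanCA := by
  unfold MeanDynamics.AlmostDiamMeanEquicontinuous
  rw [diamMeanEquicontinuityPoints_pacmanCA]
  intro h
  obtain ⟨x, hx⟩ := (dense_of_mem_residual h).nonempty_iff.2 ⟨fun _ => empty⟩
  exact hx

namespace PacmanCell

theorem rule_eq_ghost_of_isDoor {l c r : PacmanCell} (hl : IsDoor l) (h : rule l c r = ghost) :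
    r = ghostDoor := by
  revert l c r
  decide

theorem rule_pacman_ne {l r : PacmanCell} (hl : IsDoor l) :
    rule l pacman r ≠ pacman := by
  revert l r
  decide

end PacmanCell

/-! ### Door-free gaps delay the keymasters -/

/-- The interval `(a, a + L]` is free of doors and lies between doors. -/
structure IsGap (x : FullShift PacmanCell) (a : ℤ) (L : ℕ) : Prop where
  left : IsDoor (x a)
  right : IsDoor (x (a + L + 1))
  inner : ∀ j, a < j → j ≤ a + L → ¬ IsDoor (x j)
  two_le : 2 ≤ L

theorem IsGap.inner_iterate {x : FullShift PacmanCell} {a : ℤ} {L : ℕ} (h : IsGap x a L) (n : ℕ)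
    {j : ℤ} (h1 : a < j) (h2 : j ≤ a + L) : ¬ IsDoor (pacmanCA^[n] x j) := by
  rw [isDoor_iterate]
  exact h.inner j h1 h2

/-- Away from the right door a keymaster can only come from a keymaster one cell to its right. -/
theorem IsGap.key_path {x : FullShift PacmanCell} {a : ℤ} {L : ℕ} (h : IsGap x a L) {n : ℕ}
    (hn : pacmanCA^[n] x (a + 1) = key) (i : ℕ) :
    ∀ u, i < L → u + i = n → pacmanCA^[u] x (a + 1 + i) = key := by
  induction i with
  | zero =>
    rintro u - rfl
    simpa using hn
  | succ i ih =>
    intro u hi hu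
    have h1 := ih (u + 1) (by omega) (by omega)
    rw [iterate_succ_cell] at h1
    obtain ⟨-, hr | ⟨hr, -⟩⟩ := rule_eq_key h1
    · rw [← hr]
      push_cast
      rw [add_assoc (a + 1)]
    · exact absurd hr (h.inner_iterate u (by omega) (by omega))

/-- At the right end of the gap the keymaster was born from a pacman, which came from the left at
unit speed. -/
theorem IsGap.pacman_path {x : FullShift PacmanCell} {a : ℤ} {L : ℕ} (h : IsGap x a L) {n : ℕ}
    (hL : 2 * L ≤ n) (hn : pacmanCA^[n] x (a + 1) = key) (i : ℕ) :
    ∀ u, i + 2 ≤ L → u + L + i = n → pacmanCA^[u] x (a + L - 1 - i) = pacman := by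
  have h2 := h.two_le
  induction i with
  | zero =>
    intro u _ hu
    have h1 := h.key_path hn (L - 1) (u + 1) (by omega) (by omega)
    rw [show a + 1 + (L - 1 : ℕ) = a + L by omega, iterate_succ_cell] at h1
    have hd : IsDoor (pacmanCA^[u] x (a + L + 1)) := (isDoor_iterate _ _ _).2 h.right
    obtain ⟨-, hr | ⟨-, hr | hr⟩⟩ := rule_eq_key h1
    · rw [hr] at hd
      exact absurd hd (by decide)
    · simpa using hr
    -- A pacman next to the right door has no predecessor: it would have turned into a keymaster
    -- instead of moving there, and `2 ≤ L` keeps the left door away.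
    · obtain ⟨v, rfl⟩ : ∃ v, u = v + 1 := ⟨u - 1, by omega⟩
      rw [iterate_succ_cell] at hr
      rw [isDoor_iterate, ← isDoor_iterate x v] at hd
      obtain ⟨-, ⟨-, h3⟩ | ⟨h3, -⟩⟩ := rule_eq_pacman hr
      · exact absurd hd h3
      · exact absurd h3 (h.inner_iterate v (by omega) (by omega))
  | succ i ih =>
    intro u hi hu
    have h1 := ih (u + 1) (by omega) (by omega)
    rw [iterate_succ_cell] at h1
    obtain ⟨-, ⟨hl, -⟩ | ⟨hl, -⟩⟩ := rule_eq_pacman h1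
    · rwa [show a + L - 1 - i - 1 = a + L - 1 - (i + 1 : ℕ) by push_cast; ring] at hl
    · exact absurd hl (h.inner_iterate u (by omega) (by omega))

/-- The pacman arose at the left door from a ghost, whose leftward path is traced back through the
gap. -/
theorem IsGap.ghost_path {x : FullShift PacmanCell} {a : ℤ} {L : ℕ} (h : IsGap x a L) {n : ℕ}
    (hL : 3 * L ≤ n) (hn : pacmanCA^[n] x (a + 1) = key) (j : ℕ) :
    ∀ u, j + 2 ≤ L → u + 2 * L + j = n + 1 → pacmanCA^[u] x (a + 2 + j) = ghost := by
  have h2 := h.two_le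
  induction j with
  | zero =>
    intro u _ hu
    have h1 := h.pacman_path (by omega) hn (L - 2) (u + 1) (by omega) (by omega)
    rw [show a + L - 1 - (L - 2 : ℕ) = a + 1 by omega, iterate_succ_cell] at h1
    obtain ⟨v, rfl⟩ : ∃ v, u = v + 1 := ⟨u - 1, by omega⟩
    rw [add_sub_cancel_right] at h1
    have hd : IsDoor (pacmanCA^[v] x (a + 1 - 1)) := by
      rw [add_sub_cancel_right]
      exact (isDoor_iterate _ _ _).2 h.left
    obtain ⟨-, ⟨hl, -⟩ | ⟨-, hg | hg⟩⟩ := rule_eq_pacman h1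
    · have h3 := (isDoor_iterate x (v + 1) a).2 h.left
      rw [hl] at h3
      exact absurd h3 (by decide)
    · rw [iterate_succ_cell] at hg
      have h3 := rule_eq_ghost_of_isDoor hd hg
      exact absurd (Or.inr h3) (h.inner_iterate v (by omega) (by omega))
    · rwa [show a + 1 + 1 = a + 2 + (0 : ℕ) by push_cast; ring] at hg
  | succ j ih =>
    intro u hj hu
    have h1 := ih (u + 1) (by omega) (by omega)
    rw [iterate_succ_cell] at h1
    obtain ⟨-, hr | hr⟩ := rule_eq_ghost h1
    · rwa [show a + 2 + j + 1 = a + 2 + (j + 1 : ℕ) by push_cast; ring] at hr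
    · exact absurd (Or.inr hr) (h.inner_iterate u (by omega) (by omega))

/-- Past the transient, two keymasters leave a gap of length `L` at times at least `L` apart. -/
theorem IsGap.le_of_key {x : FullShift PacmanCell} {a : ℤ} {L : ℕ} (h : IsGap x a L) {n₁ n₂ : ℕ}
    (hL : 3 * L ≤ n₁) (hlt : n₁ < n₂) (hn₁ : pacmanCA^[n₁] x (a + 1) = key)
    (hn₂ : pacmanCA^[n₂] x (a + 1) = key) : n₁ + L ≤ n₂ := by
  by_contra hd
  have h2 := h.two_le
  have hpac (i u : ℕ) (hi : i + 2 ≤ L) (hu : u + 2 * L = n₁ + 2 + i) :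
      pacmanCA^[u] x (a + 1 + i) = pacman := by
    rw [show a + 1 + i = a + L - 1 - (L - 2 - i : ℕ) by omega]
    exact h.pacman_path (by omega) hn₁ (L - 2 - i) u (by omega) (by omega)
  -- The first pacman and the second ghost approach at relative speed two. For an even difference
  -- they occupy one cell at the same time; for an odd one the ghost would appear where the pacman
  -- has just been. At difference 1 two pacmen would stand in succession beside the left door.
  rcases Nat.even_or_odd' (n₂ - n₁) with ⟨i, hi | hi⟩
  · have h3 := hpac i (n₁ + 2 + i - 2 * L) (by omega) (by omega)
    have h4 := h.ghost_path (by omega) hn₂ (i - 1) (n₁ + 2 + i - 2 * L) (by omega) (by omega)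
    rw [show a + 2 + (i - 1 : ℕ) = a + 1 + i by omega, h3] at h4
    exact absurd h4 (by decide)
  · have h3 := hpac i (n₁ + 2 + i - 2 * L) (by omega) (by omega)
    rcases Nat.eq_zero_or_pos i with rfl | hpos
    · have h4 := h.pacman_path (by omega) hn₂ (L - 2) (n₁ + 2 + 0 - 2 * L + 1) (by omega) (by omega)
      rw [show a + L - 1 - (L - 2 : ℕ) = a + 1 by omega, iterate_succ_cell,
        add_sub_cancel_right] at h4
      rw [Nat.cast_zero, add_zero (a + 1)] at h3
      rw [h3] at h4
      exact rule_pacman_ne ((isDoor_iterate _ _ _).2 h.left) h4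
    · have h4 := h.ghost_path (by omega) hn₂ (i - 1) (n₁ + 2 + i - 2 * L + 1) (by omega) (by omega)
      rw [show a + 2 + (i - 1 : ℕ) = a + 1 + i by omega, iterate_succ_cell, h3] at h4
      exact rule_pacman_mid h4

/-- Each block of `L` consecutive times contains at most one element, so `t ↦ t / L` is injective on
`S`. -/
theorem card_le_of_separated {S : Finset ℕ} {n L : ℕ} (hL : 0 < L) (hS : ∀ t ∈ S, t < n)
    (hsep : ∀ t ∈ S, ∀ u ∈ S, t < u → t + L ≤ u) : S.card ≤ n / L + 1 := by
  have h := Finset.card_le_card_of_injOn (s := S) (t := Finset.range (n / L + 1)) (fun t => t / L)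
    (fun t ht => ?_) fun t ht u hu htu => ?_
  · simpa using h
  · have := Nat.div_le_div_right (c := L) (hS t ht).le
    simp only [Finset.coe_range, Set.mem_Iio]
    omega
  · by_contra hne
    have key : ∀ t ∈ S, ∀ u ∈ S, t / L = u / L → ¬ t < u := fun t ht u hu htu hlt => by
      have h1 := Nat.div_le_div_right (c := L) (hsep t ht u hu hlt)
      rw [Nat.add_div_right _ hL] at h1
      omega
    rcases lt_or_gt_of_ne hne with hlt | hlt
    · exact key t ht u hu htu hlt
    · exact key u hu t ht htu.symm hlt

/-- There is a particle in `(q, a]`. -/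
def HasParticle (q a : ℤ) (x : FullShift PacmanCell) : Prop :=
  ∃ i, q < i ∧ i ≤ a ∧ ¬ Quiet (x i)

open Classical in
/-- A region left of a gap of length `L` contains a particle for at most about the fraction
`evacuationTime / L` of the time. -/
theorem IsGap.card_hasParticle_le {x : FullShift PacmanCell} {q a : ℤ} {L : ℕ} (h : IsGap x a L)
    (hq : IsDoor (x q)) (n : ℕ) :
    ((Finset.Icc 1 n).filter fun t => HasParticle q a (pacmanCA^[t] x)).card ≤
      evacuationTime (a - q).toNat * (n / L) + evacuationTime (a - q).toNat * (3 * L + 2) := by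
  set E := evacuationTime (a - q).toNat with hE
  have h2 := h.two_le
  let I := (Finset.range n).filter fun t => 3 * L ≤ t ∧ pacmanCA^[t] x (a + 1) = key
  have hI : I.card ≤ n / L + 1 := by
    refine card_le_of_separated (by omega) (fun t ht => ?_) fun t ht u hu hlt => ?_
    · exact Finset.mem_range.1 (Finset.mem_filter.1 ht).1
    · exact h.le_of_key (Finset.mem_filter.1 ht).2.1 hlt (Finset.mem_filter.1 ht).2.2
        (Finset.mem_filter.1 hu).2.2
  -- A particle in the region at time `t ≥ E` forces an entry within the preceding `E` steps.
  -- Entries before time `3 * L` are not controlled and are all counted.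
  have hsub : ((Finset.Icc 1 n).filter fun t => HasParticle q a (pacmanCA^[t] x)) ⊆
      Finset.range E ∪ (Finset.range (3 * L) ∪ I).biUnion fun u => Finset.Ioc u (u + E) := by
    intro t ht
    obtain ⟨htn, i, h3, h4, h5⟩ := Finset.mem_filter.1 ht
    rw [Finset.mem_Icc] at htn
    by_contra hnot
    simp only [Finset.mem_union, Finset.mem_range, Finset.mem_biUnion, Finset.mem_Ioc, not_or,
      not_lt, not_exists, not_and] at hnot
    obtain ⟨s, rfl⟩ : ∃ s, t = E + s := ⟨t - E, by omega⟩
    refine h5 ?_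
    rw [Function.iterate_add_apply]
    refine quiet_of_no_input ((isDoor_iterate _ _ _).2 hq) ((isDoor_iterate _ _ _).2 h.left)
      le_rfl (fun u hu => ?_) h3 h4
    rw [← Function.iterate_add_apply]
    refine ⟨fun hk => ?_, fun hk => ?_⟩
    · refine hnot.2 (u + s) ?_ (by omega) (by omega)
      by_cases h6 : u + s < 3 * L
      · exact Or.inl h6
      · exact Or.inr (Finset.mem_filter.2 ⟨Finset.mem_range.2 (by omega), by omega, hk⟩)
    · exact h.inner_iterate (u + s) (by omega) (by omega) (Or.inr hk)
  have hU := Finset.card_biUnion_le_card_mul (Finset.range (3 * L) ∪ I)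
    (fun u => Finset.Ioc u (u + E)) E fun u _ => by simp
  have hC := (Finset.card_le_card hsub).trans (Finset.card_union_le _ _)
  have hR := Finset.card_union_le (Finset.range (3 * L)) I
  rw [Finset.card_range] at hC hR
  calc _ ≤ E + (3 * L + (n / L + 1)) * E :=
        hC.trans (Nat.add_le_add_left (hU.trans (Nat.mul_le_mul_right _ (by omega))) _)
    _ = _ := by ring

/-! ### Mean equicontinuity -/

theorem dist_le_of_no_particle {q a : ℤ} {m : ℕ} {x y : FullShift PacmanCell} (hqm : q ≤ -m)
    (hma : m ≤ a) (hxy : ∀ j, q < j → j ≤ a → (IsDoor (x j) ↔ IsDoor (y j)))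
    (hx : ¬ HasParticle q a x) (hy : ¬ HasParticle q a y) : dist x y ≤ (1 / 2 : ℝ) ^ m := by
  have hcases : ∀ v w, Quiet v → Quiet w → (IsDoor v ↔ IsDoor w) → v = w := by decide
  refine FullShift.dist_le_of_agree fun j hj => hcases _ _ ?_ ?_ (hxy j (by omega) (by omega))
  · by_contra h
    exact hx ⟨j, by omega, by omega, h⟩
  · by_contra h
    exact hy ⟨j, by omega, by omega, h⟩

/-- The bound `4 * (1 / 2) ^ m` has one share for times when both regions are quiet, one for the bad
times of each point, and one absorbing the two transients. -/
theorem eventually_average_dist_le {q a : ℤ} {L m : ℕ} {x y : FullShift PacmanCell}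
    (hqm : q ≤ -m) (hma : m ≤ a) (hx : IsGap x a L) (hy : IsGap y a L) (hxq : IsDoor (x q))
    (hyq : IsDoor (y q)) (hxy : ∀ j, q < j → j ≤ a → (IsDoor (x j) ↔ IsDoor (y j)))
    (hL : evacuationTime (a - q).toNat * 2 ^ m ≤ L) :
    ∀ᶠ n : ℕ in Filter.atTop,
      (∑ i ∈ Finset.Icc 1 n, dist (pacmanCA^[i] x) (pacmanCA^[i] y)) / (n : ℝ) ≤
        4 * (1 / 2 : ℝ) ^ m := by
  classical
  set E := evacuationTime (a - q).toNat with hE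
  have h2 := hx.two_le
  set b : ℝ := (1 / 2) ^ m with hb
  have hb0 : 0 < b := by positivity
  obtain ⟨M, hM⟩ := exists_nat_gt ((2 * (E * (3 * L + 2) : ℕ) : ℝ) / b)
  filter_upwards [Filter.eventually_ge_atTop (M + 1)] with n hn
  have hn0 : (0 : ℝ) < n := by exact_mod_cast (by omega : 0 < n)
  have hMn : (2 * (E * (3 * L + 2) : ℕ) : ℝ) ≤ n * b := by
    rw [div_lt_iff₀ hb0] at hM
    have : (M : ℝ) ≤ n := by exact_mod_cast (by omega : M ≤ n)
    nlinarith
  rw [div_le_iff₀ hn0]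
  let bad (z : FullShift PacmanCell) (t : ℕ) : ℝ :=
    if HasParticle q a (pacmanCA^[t] z) then 1 else 0
  have hbad (z : FullShift PacmanCell) (hz : IsGap z a L) (hzq : IsDoor (z q)) :
      ∑ t ∈ Finset.Icc 1 n, bad z t ≤ n * b + (E * (3 * L + 2) : ℕ) := by
    have h1 := hz.card_hasParticle_le hzq n
    rw [← hE] at h1
    have h3 : ((E * (n / L) : ℕ) : ℝ) ≤ n * b := by
      have h4 : E * (n / L) * 2 ^ m ≤ n := by
        calc E * (n / L) * 2 ^ m = (E * 2 ^ m) * (n / L) := by ring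
          _ ≤ L * (n / L) := Nat.mul_le_mul_right _ hL
          _ ≤ n := Nat.mul_div_le n L
      have h5 : ((E * (n / L) : ℕ) : ℝ) * 2 ^ m ≤ n := by exact_mod_cast h4
      have h6 : (2 : ℝ) ^ m * b = 1 := by rw [hb, ← mul_pow]; norm_num
      calc ((E * (n / L) : ℕ) : ℝ) = ((E * (n / L) : ℕ) : ℝ) * 2 ^ m * b := by
            rw [mul_assoc, h6, mul_one]
        _ ≤ n * b := mul_le_mul_of_nonneg_right h5 hb0.le
    rw [Finset.sum_boole]
    have h7 : (((Finset.Icc 1 n).filter fun t => HasParticle q a (pacmanCA^[t] z)).card : ℝ) ≤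
        (E * (n / L) : ℕ) + (E * (3 * L + 2) : ℕ) := by exact_mod_cast h1
    linarith
  calc ∑ i ∈ Finset.Icc 1 n, dist (pacmanCA^[i] x) (pacmanCA^[i] y)
      ≤ ∑ i ∈ Finset.Icc 1 n, (b + bad x i + bad y i) := by
        refine Finset.sum_le_sum fun t _ => ?_
        have h1 := FullShift.dist_le_one (pacmanCA^[t] x) (pacmanCA^[t] y)
        have h0 (z : FullShift PacmanCell) : 0 ≤ bad z t := by
          change (0 : ℝ) ≤ if HasParticle q a (pacmanCA^[t] z) then 1 else 0
          split_ifs <;> norm_num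
        by_cases hpx : HasParticle q a (pacmanCA^[t] x)
        · have : bad x t = 1 := if_pos hpx
          linarith [h0 y]
        by_cases hpy : HasParticle q a (pacmanCA^[t] y)
        · have : bad y t = 1 := if_pos hpy
          linarith [h0 x]
        have := dist_le_of_no_particle hqm hma (fun j h3 h4 => by
          rw [isDoor_iterate, isDoor_iterate]
          exact hxy j h3 h4) hpx hpy
        linarith [h0 x, h0 y]
    _ = n * b + ∑ i ∈ Finset.Icc 1 n, bad x i + ∑ i ∈ Finset.Icc 1 n, bad y i := by
        rw [Finset.sum_add_distrib, Finset.sum_add_distrib]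
        simp
    _ ≤ 4 * b * n := by linarith [hbad x hx hxq, hbad y hy hyq]

/-- The configurations with a region around `[-m, m]` that is followed by a gap that is long
compared with the evacuation time of the region. -/
def longGapSet (m : ℕ) : Set (FullShift PacmanCell) :=
  {x | ∃ (q a : ℤ) (L : ℕ), q ≤ -m ∧ m ≤ a ∧ evacuationTime (a - q).toNat * 2 ^ m ≤ L ∧
    IsDoor (x q) ∧ IsGap x a L}

theorem exists_agree_of_isGap (q a : ℤ) (L : ℕ) :
    ∃ δ : ℝ, 0 < δ ∧ ∀ x y : FullShift PacmanCell, IsGap x a L → IsDoor (x q) →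
      y ∈ Metric.ball x δ →
      IsGap y a L ∧ IsDoor (y q) ∧ ∀ j, q < j → j ≤ a → (IsDoor (x j) ↔ IsDoor (y j)) := by
  refine ⟨(1 / 2 : ℝ) ^ (q.natAbs + a.natAbs + L + 1), by positivity, fun x y hx hq hy => ?_⟩
  have heq (j : ℤ) (hj : j.natAbs ≤ q.natAbs + a.natAbs + L + 1) : y j = x j :=
    FullShift.eq_of_dist_lt hy hj
  refine ⟨⟨?_, ?_, fun j h1 h2 => ?_, hx.two_le⟩, ?_, fun j h1 h2 => ?_⟩
  · exact heq a (by omega) ▸ hx.left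
  · exact heq (a + L + 1) (by omega) ▸ hx.right
  · exact heq j (by omega) ▸ hx.inner j h1 h2
  · exact heq q (by omega) ▸ hq
  · exact iff_of_eq (congrArg IsDoor (heq j (by omega)).symm)

theorem isOpen_longGapSet (m : ℕ) : IsOpen (longGapSet m) := by
  refine Metric.isOpen_iff.2 fun x ⟨q, a, L, h1, h2, h3, hq, hx⟩ => ?_
  obtain ⟨δ, hδ, h⟩ := exists_agree_of_isGap q a L
  refine ⟨δ, hδ, fun y hy => ?_⟩
  obtain ⟨hy1, hy2, -⟩ := h x y hx hq hy
  exact ⟨q, a, L, h1, h2, h3, hy2, hy1⟩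

theorem dense_longGapSet (m : ℕ) : Dense (longGapSet m) := by
  refine dense_iff_inter_open.2 fun U hU ⟨x, hx⟩ => ?_
  obtain ⟨k, hk⟩ := FullShift.exists_agree_subset hU hx
  let M := k + m
  -- The summand 2 guarantees the minimal gap length.
  let L := evacuationTime ((M : ℤ) - -M).toNat * 2 ^ m + 2
  let z : FullShift PacmanCell := fun j =>
    if j.natAbs < M then x j else if j.natAbs = M ∨ j = M + L + 1 then door else empty
  have hdoor (j : ℤ) (h1 : ¬ j.natAbs < M) (h2 : j.natAbs = M ∨ j = M + L + 1) :
      IsDoor (z j) := by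
    have : z j = door := by
      change (if _ then _ else _) = _
      rw [if_neg h1, if_pos h2]
    exact Or.inl this
  refine ⟨z, hk z fun j hj => if_pos (by omega), -M, M, L, by omega, by omega, by omega,
    hdoor _ (by omega) (by omega), hdoor _ (by omega) (by omega), hdoor _ (by omega) (by omega),
    fun j h1 h2 => ?_, by omega⟩
  have : z j = empty := by
    change (if _ then _ else _) = _
    rw [if_neg (by omega), if_neg (by omega)]
  rw [this]
  decide

theorem iInter_longGapSet_subset :
    ⋂ m, longGapSet m ⊆ MeanDynamics.meanEquicontinuityPoints pacmanCA := by
  intro x hx ε hε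
  obtain ⟨m, hm⟩ := exists_pow_lt_of_lt_one (show 0 < ε / 4 by linarith)
    (by norm_num : (1 / 2 : ℝ) < 1)
  obtain ⟨q, a, L, h1, h2, h3, hq, hgap⟩ := Set.mem_iInter.1 hx m
  obtain ⟨δ, hδ, h⟩ := exists_agree_of_isGap q a L
  refine ⟨δ, hδ, fun y hy => ?_⟩
  obtain ⟨hy1, hy2, hy3⟩ := h x y hgap hq hy
  have hev := eventually_average_dist_le h1 h2 hgap hy1 hq hy2 hy3 h3
  refine (Filter.limsup_le_of_le ?_ hev).trans_lt (by linarith)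
  -- A real `limsup` is bounded by an eventual upper bound only given coboundedness, which
  -- nonnegativity of the averages supplies.
  refine (Filter.isBoundedUnder_of ⟨0, fun n => ?_⟩ :
    Filter.IsBoundedUnder (· ≥ ·) Filter.atTop _).isCoboundedUnder_le
  exact div_nonneg (Finset.sum_nonneg fun _ _ => dist_nonneg) (Nat.cast_nonneg n)

theorem almostMeanEquicontinuous_pacmanCA :
    MeanDynamics.AlmostMeanEquicontinuous pacmanCA :=
  Filter.mem_of_superset (countable_iInter_mem.2 fun m =>
    residual_of_dense_open (isOpen_longGapSet m) (dense_longGapSet m)) iInter_longGapSet_subset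

theorem mainTheorem2 :
    FullShift.IsCellularAutomaton pacmanCA ∧
    MeanDynamics.AlmostMeanEquicontinuous pacmanCA ∧
    Dense (MeanDynamics.meanEquicontinuityPoints pacmanCA) ∧
    ¬ MeanDynamics.AlmostDiamMeanEquicontinuous pacmanCA ∧
    MeanDynamics.CofinitelySensitive pacmanCA ∧
    MeanDynamics.diamMeanEquicontinuityPoints pacmanCA = ∅ ∧
    (∃ c : ℝ, 0 < c ∧ ∀ (x : FullShift PacmanCell) (δ : ℝ), 0 < δ →
      ∀ᶠ n : ℕ in Filter.atTop,
        c < MeanDynamics.diamAverage pacmanCA (Metric.ball x δ) n) :=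
  ⟨isCellularAutomaton_pacmanCA, almostMeanEquicontinuous_pacmanCA,
    dense_of_mem_residual almostMeanEquicontinuous_pacmanCA,
    not_almostDiamMeanEquicontinuous_pacmanCA, cofinitelySensitive_pacmanCA,
    diamMeanEquicontinuityPoints_pacmanCA, 1 / 2, by norm_num,
    fun x _ hδ => eventually_lt_diamAverage x hδ⟩
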